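/- Let $(\mathcal{C},\mathbb{E},\mathfrak{s})$ be an extriangulated category in the sense of Nakaoka and Palu that satisfies Condition (WIC): if $gf$ is an inflation then so is $f$, and if $gf$ is a deflation then so is $g$. Let $\xi$ be a proper class of $\mathbb{E}$-triangles, that is, a class closed under isomorphisms, finite coproducts, base change and cobase change, containing all split $\mathbb{E}$-triangles, and saturated: if $A_2\to B_2\xrightarrow{y_2}C\overset{\delta_2}{\dashrightarrow}$ and $A_1\to M\to B_2\overset{y_2^*\delta_1}{\dashrightarrow}$ are in $\xi$, then so is every $\mathbb{E}$-triangle $A_1\to B_1\to C\overset{\delta_1}{\dashrightarrow}$. Assume that $\mathcal{C}$ has enough $\xi$-projectives and enough $\xi$-injectives. Let $\mathcal{W}$ be a class of objects of $\mathcal{C}$ closed under finite direct sums. An $\mathbb{E}$-triangle $A\to B\to C\dashrightarrow$ in $\xi$ is called $\mathcal{C}(-,\mathcal{W})$-exact (respectively $\mathcal{C}(\mathcal{W},-)$-exact) if for all $V\in\mathcal{W}$ the sequence $0\to\mathcal{C}(C,V)\to\mathcal{C}(B,V)\to\mathcal{C}(A,V)\to0$ (respectively $0\to\mathcal{C}(V,A)\to\mathcal{C}(V,B)\to\mathcal{C}(V,C)\to0$)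 is exact. For $m\in\mathbb{N}\cup\{\infty\}$, a sequence $0\to A\to W_0\to W_1\to\cdots\to W_m$ (which goes on forever if $m=\infty$) is called $\mathcal{C}(-,\mathcal{W})$-exact (respectively $\mathcal{C}(\mathcal{W},-)$-exact) if there are $\mathcal{C}(-,\mathcal{W})$-exact (respectively $\mathcal{C}(\mathcal{W},-)$-exact) $\mathbb{E}$-triangles $K_i\xrightarrow{g_i}W_i\xrightarrow{f_i}K_{i+1}\dashrightarrow$ in $\xi$ for all $0\le i\le m$ (all $i\geq 0$ if $m=\infty$), with $K_0=A$, such that $g_0$ is the map $A\to W_0$ and the map $W_i\to W_{i+1}$ is $g_{i+1}f_i$ for $0\le i<m$. It is called a coproper $\mathcal{W}(\xi)$-coresolution of $A$ if it is $\mathcal{C}(-,\mathcal{W})$-exact and all $W_i$ are in $\mathcal{W}$. The same terms are used for the sequence $0\to A$ without any $W_i$ (the case $m=-1$), for which the conditions are empty. Theorem. Let $Y\to Y^0\to Y^1\dashrightarrow$ be a $\mathcal{C}(-,\mathcal{W})$-exact $\mathbb{E}$-triangle in $\xi$, let $n\in\mathbb{N}\cup\{\infty\}$, and let $$0\to Y^0\to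 W^0_0\to W^0_1\to\cdots\to W^0_n\qquad\text{and}\qquad 0\to Y^1\to W^1_0\to W^1_1\to\cdots\to W^1_{n-1}$$ be coproper $\mathcal{W}(\xi)$-coresolutions of $Y^0$ and $Y^1$, respectively (both infinite if $n=\infty$). Then there is a coproper $\mathcal{W}(\xi)$-coresolution of $Y$ $$0\to Y\to W^0_0\to W^1_0\oplus W^0_1\to W^1_1\oplus W^0_2\to\cdots\to W^1_{n-1}\oplus W^0_n$$ (infinite if $n=\infty$) such that, if the two given coresolutions and the $\mathbb{E}$-triangle $Y\to Y^0\to Y^1\dashrightarrow$ are moreover $\mathcal{C}(\mathcal{W},-)$-exact, then so is this coresolution of $Y$. -/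

import Mathlib

open CategoryTheory CategoryTheory.Limits Opposite

universe w v u

namespace Extriangulated

section Pre

variable {C : Type u} [Category.{v} C]

/-- A pair of composable morphisms `A ⟶ mid ⟶ D` with fixed end terms. -/
structure Seq (A D : C) where
  mid : C
  f : A ⟶ mid
  g : mid ⟶ D

/-- Two sequences with the same end terms are equivalent when an isomorphism of the middle
terms is compatible with the morphisms. -/
instance seqSetoid (A D : C) : Setoid (Seq A D) where
  r S T := ∃ b : S.mid ≅ T.mid, S.f ≫ b.hom = T.f ∧ b.hom ≫ T.g = S.g
  iseqv :=
    { refl := fun S => ⟨Iso.refl _, by simp, by simp⟩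
      symm := by
        rintro S T ⟨b, h₁, h₂⟩
        exact ⟨b.symm, by simp [← h₁], by simp [← h₂]⟩
      trans := by
        rintro S T U ⟨b, h₁, h₂⟩ ⟨c, h₃, h₄⟩
        exact ⟨b ≪≫ c, by simp [← h₃, ← h₁], by simp [h₄, h₂]⟩ }

end Pre

/-- The data underlying an extriangulated category: an additive bifunctor `E`
(contravariant in the first variable, covariant in the second one) to abelian groups, and a
correspondence `s` which sends every element of `E(D, A)` to an equivalence class of
sequences `A ⟶ B ⟶ D`. -/
structure ExtData (C : Type u) [Category.{v} C] [Preadditive C] where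
  E : Cᵒᵖ ⥤ C ⥤ AddCommGrpCat.{w}
  additive_left : E.Additive
  additive_right : ∀ X : Cᵒᵖ, (E.obj X).Additive
  s : ∀ {D A : C}, (E.obj (op D)).obj A → Quotient (seqSetoid A D)

namespace ExtData

variable {C : Type u} [Category.{v} C] [Preadditive C] (𝓔 : ExtData.{w} C)

/-- The group `E(D, A)` of extensions. -/
abbrev Ext (D A : C) : Type w := (𝓔.E.obj (op D)).obj A

variable {𝓔}

/-- `a_* δ`. -/
def push {D A A' : C} (a : A ⟶ A') (δ : 𝓔.Ext D A) : 𝓔.Ext D A' :=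
  (𝓔.E.obj (op D)).map a δ

/-- `c^* δ`. -/
def pull {D D' A : C} (c : D' ⟶ D) (δ : 𝓔.Ext D A) : 𝓔.Ext D' A :=
  (𝓔.E.map c.op).app A δ

/-- `s(δ) = [A ⟶ B ⟶ D]`. -/
def Realizes {A B D : C} (x : A ⟶ B) (y : B ⟶ D) (δ : 𝓔.Ext D A) : Prop :=
  𝓔.s δ = Quotient.mk (seqSetoid A D) ⟨B, x, y⟩

/-- The direct sum `δ ⊕ δ'` in `E(D ⊞ D', A ⊞ A')`. -/
noncomputable def extSum [HasBinaryBiproducts C] {A A' D D' : C}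
    (δ : 𝓔.Ext D A) (δ' : 𝓔.Ext D' A') : 𝓔.Ext (D ⊞ D') (A ⊞ A') :=
  push biprod.inl (pull biprod.fst δ) + push biprod.inr (pull biprod.snd δ')

variable (𝓔)

/-- The axioms of an extriangulated category (Nakaoka and Palu). Additivity of the bifunctor
is part of `ExtData`. -/
structure IsExtriangulated [HasBinaryBiproducts C] : Prop where
  /-- `s` is a realization: morphisms of extensions lift to the middle terms. -/
  realization : ∀ {A B D A' B' D' : C} {x : A ⟶ B} {y : B ⟶ D} {δ : 𝓔.Ext D A}
    {x' : A' ⟶ B'} {y' : B' ⟶ D'} {δ' : 𝓔.Ext D' A'},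
    Realizes x y δ → Realizes x' y' δ' →
    ∀ (a : A ⟶ A') (c : D ⟶ D'), push a δ = pull c δ' →
      ∃ b : B ⟶ B', x ≫ b = a ≫ x' ∧ y ≫ c = b ≫ y'
  /-- `s` is additive: the zero extension is realized by the split sequence. -/
  realizes_zero : ∀ A D : C,
    Realizes (biprod.inl : A ⟶ A ⊞ D) (biprod.snd : A ⊞ D ⟶ D) (0 : 𝓔.Ext D A)
  /-- `s` is additive: `s(δ ⊕ δ') = s(δ) ⊕ s(δ')`. -/
  realizes_sum : ∀ {A B D A' B' D' : C} {x : A ⟶ B} {y : B ⟶ D} {δ : 𝓔.Ext D A}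
    {x' : A' ⟶ B'} {y' : B' ⟶ D'} {δ' : 𝓔.Ext D' A'},
    Realizes x y δ → Realizes x' y' δ' →
      Realizes (biprod.map x x') (biprod.map y y') (extSum δ δ')
  /-- (ET3) -/
  et3 : ∀ {A B D A' B' D' : C} {x : A ⟶ B} {y : B ⟶ D} {δ : 𝓔.Ext D A}
    {x' : A' ⟶ B'} {y' : B' ⟶ D'} {δ' : 𝓔.Ext D' A'},
    Realizes x y δ → Realizes x' y' δ' →
    ∀ (a : A ⟶ A') (b : B ⟶ B'), x ≫ b = a ≫ x' →
      ∃ c : D ⟶ D', y ≫ c = b ≫ y' ∧ push a δ = pull c δ'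
  /-- (ET3)ᵒᵖ -/
  et3_op : ∀ {A B D A' B' D' : C} {x : A ⟶ B} {y : B ⟶ D} {δ : 𝓔.Ext D A}
    {x' : A' ⟶ B'} {y' : B' ⟶ D'} {δ' : 𝓔.Ext D' A'},
    Realizes x y δ → Realizes x' y' δ' →
    ∀ (b : B ⟶ B') (c : D ⟶ D'), y ≫ c = b ≫ y' →
      ∃ a : A ⟶ A', x ≫ b = a ≫ x' ∧ push a δ = pull c δ'
  /-- (ET4) -/
  et4 : ∀ {A B D M F : C} {f : A ⟶ B} {f' : B ⟶ D} {δ : 𝓔.Ext D A}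
    {g : B ⟶ M} {g' : M ⟶ F} {δ' : 𝓔.Ext F B},
    Realizes f f' δ → Realizes g g' δ' →
      ∃ (N : C) (h' : M ⟶ N) (d : D ⟶ N) (e : N ⟶ F) (δ'' : 𝓔.Ext N A),
        g ≫ h' = f' ≫ d ∧ h' ≫ e = g' ∧
        Realizes (f ≫ g) h' δ'' ∧ Realizes d e (push f' δ') ∧
        pull d δ'' = δ ∧ push f δ'' = pull e δ'
  /-- (ET4)ᵒᵖ -/
  et4_op : ∀ {D A B F M : C} {f' : D ⟶ A} {f : A ⟶ B} {δ : 𝓔.Ext B D}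
    {g' : F ⟶ B} {g : B ⟶ M} {δ' : 𝓔.Ext M F},
    Realizes f' f δ → Realizes g' g δ' →
      ∃ (N : C) (h' : N ⟶ A) (d : D ⟶ N) (e : N ⟶ F) (δ'' : 𝓔.Ext M N),
        h' ≫ f = e ≫ g' ∧ d ≫ h' = f' ∧
        Realizes h' (f ≫ g) δ'' ∧ Realizes d e (pull g' δ) ∧
        push e δ'' = δ' ∧ push d δ = pull g δ''

/-- An `E`-triangle `A ⟶ B ⟶ D ⇢`. -/
structure ETriangle where
  {A : C}
  {B : C}
  {D : C}
  x : A ⟶ B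
  y : B ⟶ D
  δ : 𝓔.Ext D A
  realizes : Realizes x y δ

/-- A morphism is an inflation if it is the first morphism of some `E`-triangle. -/
def IsInflation {A B : C} (f : A ⟶ B) : Prop :=
  ∃ (D : C) (y : B ⟶ D) (δ : 𝓔.Ext D A), Realizes f y δ

/-- A morphism is a deflation if it is the second morphism of some `E`-triangle. -/
def IsDeflation {B D : C} (g : B ⟶ D) : Prop :=
  ∃ (A : C) (x : A ⟶ B) (δ : 𝓔.Ext D A), Realizes x g δ

/-- Condition (WIC). -/
structure WIC : Prop where
  inflation : ∀ {X Y Z : C} (f : X ⟶ Y) (g : Y ⟶ Z),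
    𝓔.IsInflation (f ≫ g) → 𝓔.IsInflation f
  deflation : ∀ {X Y Z : C} (f : X ⟶ Y) (g : Y ⟶ Z),
    𝓔.IsDeflation (f ≫ g) → 𝓔.IsDeflation g

variable {𝓔}

/-- A proper class of `E`-triangles. In `saturated`, the remaining part of the usual
commutative diagram over `D` exists automatically. -/
structure IsProperClass [HasBinaryBiproducts C] (ξ : Set 𝓔.ETriangle) : Prop where
  /-- closed under isomorphisms of `E`-triangles -/
  iso_closed : ∀ (S T : 𝓔.ETriangle) (a : S.A ≅ T.A) (b : S.B ≅ T.B) (c : S.D ≅ T.D),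
    S.x ≫ b.hom = a.hom ≫ T.x → S.y ≫ c.hom = b.hom ≫ T.y →
    push a.hom S.δ = pull c.hom T.δ → S ∈ ξ → T ∈ ξ
  /-- closed under finite coproducts (the empty one is covered by `split_mem`) -/
  sum_mem : ∀ S ∈ ξ, ∀ T ∈ ξ,
    ∀ h : Realizes (biprod.map S.x T.x) (biprod.map S.y T.y) (extSum S.δ T.δ),
      (⟨_, _, _, h⟩ : 𝓔.ETriangle) ∈ ξ
  /-- contains the split `E`-triangles -/
  split_mem : ∀ T : 𝓔.ETriangle, T.δ = 0 → T ∈ ξ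
  /-- closed under base change -/
  base_change : ∀ T ∈ ξ, ∀ {B' D' : C} (c : D' ⟶ T.D) (x' : T.A ⟶ B') (y' : B' ⟶ D')
    (h : Realizes x' y' (pull c T.δ)), (⟨x', y', _, h⟩ : 𝓔.ETriangle) ∈ ξ
  /-- closed under cobase change -/
  cobase_change : ∀ T ∈ ξ, ∀ {A' B' : C} (a : T.A ⟶ A') (x' : A' ⟶ B') (y' : B' ⟶ T.D)
    (h : Realizes x' y' (push a T.δ)), (⟨x', y', _, h⟩ : 𝓔.ETriangle) ∈ ξ
  /-- saturated -/
  saturated : ∀ {A₁ B₁ A₂ B₂ D M : C} (x₁ : A₁ ⟶ B₁) (y₁ : B₁ ⟶ D) (δ₁ : 𝓔.Ext D A₁)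
    (h₁ : Realizes x₁ y₁ δ₁) (x₂ : A₂ ⟶ B₂) (y₂ : B₂ ⟶ D) (δ₂ : 𝓔.Ext D A₂)
    (h₂ : Realizes x₂ y₂ δ₂) (m₁ : A₁ ⟶ M) (e₁ : M ⟶ B₂)
    (h : Realizes m₁ e₁ (pull y₂ δ₁)),
    (⟨x₂, y₂, δ₂, h₂⟩ : 𝓔.ETriangle) ∈ ξ → (⟨m₁, e₁, _, h⟩ : 𝓔.ETriangle) ∈ ξ →
      (⟨x₁, y₁, δ₁, h₁⟩ : 𝓔.ETriangle) ∈ ξ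

/-- `0 ⟶ C(V, A) ⟶ C(V, B) ⟶ C(V, D) ⟶ 0` is exact. -/
def ETriangle.HomFromExact (T : 𝓔.ETriangle) (V : C) : Prop :=
  Function.Injective (fun f : V ⟶ T.A => f ≫ T.x) ∧
  Function.Exact (fun f : V ⟶ T.A => f ≫ T.x) (fun f : V ⟶ T.B => f ≫ T.y) ∧
  Function.Surjective (fun f : V ⟶ T.B => f ≫ T.y)

/-- `0 ⟶ C(D, V) ⟶ C(B, V) ⟶ C(A, V) ⟶ 0` is exact. -/
def ETriangle.HomToExact (T : 𝓔.ETriangle) (V : C) : Prop :=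
  Function.Injective (fun f : T.D ⟶ V => T.y ≫ f) ∧
  Function.Exact (fun f : T.D ⟶ V => T.y ≫ f) (fun f : T.B ⟶ V => T.x ≫ f) ∧
  Function.Surjective (fun f : T.B ⟶ V => T.x ≫ f)

/-- `ξ`-projective objects. -/
def IsXiProjective (ξ : Set 𝓔.ETriangle) (P : C) : Prop :=
  ∀ T ∈ ξ, T.HomFromExact P

/-- `ξ`-injective objects. -/
def IsXiInjective (ξ : Set 𝓔.ETriangle) (I : C) : Prop :=
  ∀ T ∈ ξ, T.HomToExact I

/-- Every object `A` has an `E`-triangle `K ⟶ P ⟶ A ⇢` in `ξ` with `P` `ξ`-projective. -/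
def EnoughXiProjectives (ξ : Set 𝓔.ETriangle) : Prop :=
  ∀ A : C, ∃ (K P : C) (x : K ⟶ P) (y : P ⟶ A) (δ : 𝓔.Ext A K) (h : Realizes x y δ),
    (⟨x, y, δ, h⟩ : 𝓔.ETriangle) ∈ ξ ∧ IsXiProjective ξ P

/-- Every object `A` has an `E`-triangle `A ⟶ I ⟶ K ⇢` in `ξ` with `I` `ξ`-injective. -/
def EnoughXiInjectives (ξ : Set 𝓔.ETriangle) : Prop :=
  ∀ A : C, ∃ (I K : C) (x : A ⟶ I) (y : I ⟶ K) (δ : 𝓔.Ext K A) (h : Realizes x y δ),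
    (⟨x, y, δ, h⟩ : 𝓔.ETriangle) ∈ ξ ∧ IsXiInjective ξ I

/-- The `C(𝒲, -)`-exact `E`-triangles in `ξ`. -/
def homFromExactTriangles (ξ : Set 𝓔.ETriangle) (𝒲 : ObjectProperty C) : Set 𝓔.ETriangle :=
  {T | T ∈ ξ ∧ ∀ V, 𝒲 V → T.HomFromExact V}

/-- The `C(-, 𝒲)`-exact `E`-triangles in `ξ`. -/
def homToExactTriangles (ξ : Set 𝓔.ETriangle) (𝒲 : ObjectProperty C) : Set 𝓔.ETriangle :=
  {T | T ∈ ξ ∧ ∀ V, 𝒲 V → T.HomToExact V}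

/-- The sequence of objects `Y, K 0, K 1, …`. -/
def consObj (Y : C) (K : ℕ → C) : ℕ → C
  | 0 => Y
  | i + 1 => K i

/-- The sequence `0 ⟶ Y ⟶ W 0 ⟶ W 1 ⟶ ⋯` with exactly the `ℓ` terms `W i`, `i < ℓ` (all
`i` if `ℓ = ⊤`), is obtained by splicing `E`-triangles `K_i ⟶ W i ⟶ K_{i+1} ⇢` in the class
`𝒯`, where `K_0 = Y` (and `K_{i+1}` is called `K i` below). Values of `W` and `d` outside
the range are irrelevant. That consecutive maps compose to zero is automatic. -/
def IsSpliced (𝒯 : Set 𝓔.ETriangle) (ℓ : ℕ∞) (Y : C) (W : ℕ → C) (ε : Y ⟶ W 0)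
    (d : ∀ i, W i ⟶ W (i + 1)) : Prop :=
  ∃ (K : ℕ → C) (g : ∀ i, consObj Y K i ⟶ W i) (f : ∀ i, W i ⟶ K i),
    g 0 = ε ∧
    (∀ i : ℕ, ((i + 1 : ℕ) : ℕ∞) < ℓ → d i = f i ≫ g (i + 1)) ∧
    (∀ i : ℕ, (i : ℕ∞) < ℓ →
      ∃ (δ : 𝓔.Ext (K i) (consObj Y K i)) (h : Realizes (g i) (f i) δ),
        (⟨g i, f i, δ, h⟩ : 𝓔.ETriangle) ∈ 𝒯)

/-- A coproper `𝒲(ξ)`-coresolution with `ℓ` terms: all terms are in `𝒲`, and the sequence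
is a `C(-, 𝒲)`-exact `ξ`-exact complex. -/
def IsCoproperCoresolution (ξ : Set 𝓔.ETriangle) (𝒲 : ObjectProperty C) (ℓ : ℕ∞) (Y : C)
    (W : ℕ → C) (ε : Y ⟶ W 0) (d : ∀ i, W i ⟶ W (i + 1)) : Prop :=
  (∀ i : ℕ, (i : ℕ∞) < ℓ → 𝒲 (W i)) ∧ IsSpliced (homToExactTriangles ξ 𝒲) ℓ Y W ε d

/-- The sequence of objects `U 0, V 0 ⊞ U 1, V 1 ⊞ U 2, …`. -/
noncomputable def sumTerms [HasBinaryBiproducts C] (U V : ℕ → C) : ℕ → C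
  | 0 => U 0
  | i + 1 => V i ⊞ U (i + 1)

end ExtData

end Extriangulated

open Extriangulated Extriangulated.ExtData

/-!
The new coresolution is built from left to right. Write `K⁰_i` and `K¹_i` for the objects at
which the given coresolutions of `Y⁰` and `Y¹` are spliced, so that `K⁰_0 = Y⁰` and `K¹_0 = Y¹`.

(ET4) applied to the composite `Y ⟶ Y⁰ ⟶ W⁰_0` yields triangles `Y ⟶ W⁰_0 ⟶ Z_1` and
`Y¹ ⟶ Z_1 ⟶ K⁰_1` (`IsBiexact.comp`). From then on a horseshoe lemma (`IsBiexact.horseshoe`)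
turns a triangle `K¹_i ⟶ Z_{i+1} ⟶ K⁰_{i+1}` into triangles
`Z_{i+1} ⟶ W¹_i ⊞ W⁰_{i+1} ⟶ Z_{i+2}` and `K¹_{i+1} ⟶ Z_{i+2} ⟶ K⁰_{i+2}`. It is again an
instance of `IsBiexact.comp`: since `K¹_i ⟶ W¹_i` extends to `Z_{i+1}`, the cobase change of
`K¹_i ⟶ W¹_i ⟶ K¹_{i+1}` along `K¹_i ⟶ Z_{i+1}` has the form
`Z_{i+1} ⟶ W¹_i ⊞ K⁰_{i+1} ⟶ K¹_{i+1}` (`exists_cobaseChange`), and its inflation is composed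
with `W¹_i ⊞ K⁰_{i+1} ⟶ W¹_i ⊞ W⁰_{i+1}`.

All triangles are cobase changes of triangles in `ξ`, except for the composites, which need the
dual of saturation: if `A ⟶ B` is the inflation of a triangle in `ξ` and the cobase change of an
extension of `A` along it is in `ξ`, then so is the extension
(`IsProperClass.mem_of_push_mem`). The deflations and inflations of a triangle in `ξ` need not
be epimorphisms and monomorphisms, so the injectivity parts of the two exactness conditions are
carried through the construction as well.

The `C(𝒲, -)`-exactness of the given coresolutions may be witnessed by splicing triangles other
than the `C(-, 𝒲)`-exact ones, but these triangles are unique up to isomorphism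
(`IsCoproperCoresolution.isSpliced_inter`). To treat both exactness conditions at once, the
triangles are required to be `C(-, 𝒲)`-exact and `C(𝒱, -)`-exact for a second class `𝒱`.
-/

namespace Extriangulated

namespace ExtData

open ZeroObject

variable {C : Type u} [Category.{v} C] [Preadditive C] {𝓔 : ExtData.{w} C}

/-! ### Extensions and their realizations -/

@[simp] lemma push_zero {D A A' : C} (a : A ⟶ A') : push a (0 : 𝓔.Ext D A) = 0 :=
  map_zero ((𝓔.E.obj (op D)).map a).hom

@[simp] lemma push_id {D A : C} (δ : 𝓔.Ext D A) : push (𝟙 A) δ = δ := by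
  simp [push]

lemma push_comp {D A A' A'' : C} (a : A ⟶ A') (a' : A' ⟶ A'') (δ : 𝓔.Ext D A) :
    push (a ≫ a') δ = push a' (push a δ) := by
  simp [push]

@[simp] lemma pull_zero {D D' A : C} (c : D' ⟶ D) : pull c (0 : 𝓔.Ext D A) = 0 :=
  map_zero ((𝓔.E.map c.op).app A).hom

@[simp] lemma pull_id {D A : C} (δ : 𝓔.Ext D A) : pull (𝟙 D) δ = δ := by
  simp [pull]

lemma pull_comp {D D' D'' A : C} (c : D'' ⟶ D') (c' : D' ⟶ D) (δ : 𝓔.Ext D A) :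
    pull (c ≫ c') δ = pull c (pull c' δ) := by
  simp [pull]

lemma push_pull {D D' A A' : C} (a : A ⟶ A') (c : D' ⟶ D) (δ : 𝓔.Ext D A) :
    push a (pull c δ) = pull c (push a δ) := by
  have := (𝓔.E.map c.op).naturality a
  exact (ConcreteCategory.congr_hom this δ).symm

lemma push_sub_right {D A A' : C} (a : A ⟶ A') (δ δ' : 𝓔.Ext D A) :
    push a (δ - δ') = push a δ - push a δ' :=
  map_sub ((𝓔.E.obj (op D)).map a).hom δ δ'

lemma pull_sub_left {D D' A : C} (c c' : D' ⟶ D) (δ : 𝓔.Ext D A) :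
    pull (c - c') δ = pull c δ - pull c' δ := by
  have := 𝓔.additive_left
  simp [pull, op_sub, Functor.map_sub]

lemma exists_realizes {D A : C} (δ : 𝓔.Ext D A) :
    ∃ (B : C) (x : A ⟶ B) (y : B ⟶ D), Realizes x y δ := by
  obtain ⟨S, hS⟩ := Quotient.exists_rep (𝓔.s δ)
  exact ⟨S.mid, S.f, S.g, hS.symm⟩

lemma Realizes.exists_iso {A B B' D : C} {x : A ⟶ B} {y : B ⟶ D} {x' : A ⟶ B'} {y' : B' ⟶ D}
    {δ : 𝓔.Ext D A} (h : Realizes x y δ) (h' : Realizes x' y' δ) :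
    ∃ b : B ≅ B', x ≫ b.hom = x' ∧ b.hom ≫ y' = y :=
  Quotient.exact (h.symm.trans h')

lemma Realizes.of_iso_mid {A B B' D : C} {x : A ⟶ B} {y : B ⟶ D} {x' : A ⟶ B'} {y' : B' ⟶ D}
    {δ : 𝓔.Ext D A} (h : Realizes x y δ) (b : B ≅ B') (hx : x ≫ b.hom = x')
    (hy : b.hom ≫ y' = y) : Realizes x' y' δ :=
  h.trans (Quotient.sound ⟨b, hx, hy⟩)

lemma IsSpliced.mono {𝒯 𝒯' : Set 𝓔.ETriangle} (h𝒯 : 𝒯 ⊆ 𝒯') {ℓ : ℕ∞} {Y : C} {W : ℕ → C}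
    {ε : Y ⟶ W 0} {d : ∀ i, W i ⟶ W (i + 1)} (h : IsSpliced 𝒯 ℓ Y W ε d) :
    IsSpliced 𝒯' ℓ Y W ε d := by
  obtain ⟨K, g, f, h₀, h₁, h₂⟩ := h
  refine ⟨K, g, f, h₀, h₁, fun i hi => ?_⟩
  obtain ⟨δ, h, hT⟩ := h₂ i hi
  exact ⟨δ, h, h𝒯 hT⟩

/-! ### Exact sequences -/

variable [HasBinaryBiproducts C]

section Exact

variable {A B D : C} {x : A ⟶ B} {y : B ⟶ D} {δ : 𝓔.Ext D A}

lemma exists_extension (h𝓔 : 𝓔.IsExtriangulated) (h : Realizes x y δ) {P : C} (f : A ⟶ P)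
    (hf : push f δ = 0) : ∃ g : B ⟶ P, x ≫ g = f := by
  obtain ⟨b, hb, -⟩ := h𝓔.realization h (h𝓔.realizes_zero P D) f (𝟙 D) (by simpa using hf)
  exact ⟨b ≫ biprod.fst, by simp [reassoc_of% hb]⟩

lemma exists_lift (h𝓔 : 𝓔.IsExtriangulated) (h : Realizes x y δ) {P : C} (f : P ⟶ D)
    (hf : pull f δ = 0) : ∃ g : P ⟶ B, g ≫ y = f := by
  obtain ⟨b, -, hb⟩ := h𝓔.realization (h𝓔.realizes_zero A P) h (𝟙 A) f (by simpa using hf.symm)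
  exact ⟨biprod.inr ≫ b, by simp [← hb]⟩

/-- The long exact sequence at `E(P, A)`: the kernel of `x_*` consists of the base changes
of `δ`. -/
lemma exists_eq_pull (h𝓔 : 𝓔.IsExtriangulated) (h : Realizes x y δ) {P : C} (ε : 𝓔.Ext P A)
    (hε : push x ε = 0) : ∃ c : P ⟶ D, ε = pull c δ := by
  obtain ⟨M, p, q, hM⟩ := exists_realizes ε
  obtain ⟨b, hb⟩ := exists_extension h𝓔 hM x hε
  obtain ⟨c, -, hc⟩ := h𝓔.et3 hM h (𝟙 A) b (by simpa using hb)
  exact ⟨c, by simpa using hc⟩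

lemma Realizes.pull_eq_zero (h𝓔 : 𝓔.IsExtriangulated) (h : Realizes x y δ) : pull y δ = 0 := by
  obtain ⟨c, hc, hc'⟩ := h𝓔.et3 (h𝓔.realizes_zero A B) h (𝟙 A) (biprod.desc x (𝟙 B)) (by simp)
  have : c = y := by simpa using congrArg (fun t => biprod.inr ≫ t) hc
  simpa [this] using hc'.symm

lemma Realizes.push_eq_zero (h𝓔 : 𝓔.IsExtriangulated) (h : Realizes x y δ) : push x δ = 0 := by
  obtain ⟨a, ha, ha'⟩ := h𝓔.et3_op h (h𝓔.realizes_zero B D) (biprod.lift (𝟙 B) y) (𝟙 D) (by simp)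
  have : a = x := by simpa using (congrArg (fun t => t ≫ biprod.fst) ha).symm
  simpa [this] using ha'

variable {A' B' D' : C} {x' : A' ⟶ B'} {y' : B' ⟶ D'} {δ' : 𝓔.Ext D' A'}

/-- The five lemma for the third terms. Morphisms `c` and `c'` in both directions exist; they
need not be inverse to each other, but `c ≫ c' - 𝟙` factors through `y` and is annihilated by
`y`, so it squares to zero. -/
lemma exists_iso_right (h𝓔 : 𝓔.IsExtriangulated) (h : Realizes x y δ) (h' : Realizes x' y' δ')
    (a : A ≅ A') (b : B ≅ B') (hx : x ≫ b.hom = a.hom ≫ x') :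
    ∃ c : D ≅ D', y ≫ c.hom = b.hom ≫ y' := by
  have hx' : x' ≫ b.inv = a.inv ≫ x := by rw [Iso.comp_inv_eq, Category.assoc, hx]; simp
  obtain ⟨c, hc, hcδ⟩ := h𝓔.et3 h h' a.hom b.hom hx
  obtain ⟨c', hc', hcδ'⟩ := h𝓔.et3 h' h a.inv b.inv hx'
  have key : ∀ {A B D : C} {x : A ⟶ B} {y : B ⟶ D} {δ : 𝓔.Ext D A}, Realizes x y δ →
      ∀ e : D ⟶ D, y ≫ e = y → pull e δ = δ → e ≫ (𝟙 D - (e - 𝟙 D)) = 𝟙 D ∧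
        (𝟙 D - (e - 𝟙 D)) ≫ e = 𝟙 D := by
    intro A B D x y δ h e he heδ
    obtain ⟨s, hs⟩ := exists_lift h𝓔 h (e - 𝟙 D) (by simp [pull_sub_left, heδ])
    have hsq : (e - 𝟙 D) ≫ (e - 𝟙 D) = 0 := by
      nth_rw 1 [← hs]
      simp [he]
    simp only [Preadditive.comp_sub, Preadditive.sub_comp, Category.comp_id,
      Category.id_comp] at hsq ⊢
    constructor
    · rw [← sub_eq_zero, ← neg_eq_zero, ← hsq]; abel
    · rw [← sub_eq_zero, ← neg_eq_zero, ← hsq]; abel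
  have h₁ := (key h (c ≫ c') (by simp [reassoc_of% hc, hc'])
    (by rw [pull_comp, ← hcδ', ← push_pull, ← hcδ, ← push_comp]; simp)).1
  have h₂ := (key h' (c' ≫ c) (by simp [reassoc_of% hc', hc])
    (by rw [pull_comp, ← hcδ, ← push_pull, ← hcδ', ← push_comp]; simp)).2
  rw [Category.assoc] at h₁
  rw [← Category.assoc] at h₂
  have : IsIso c := by
    refine ⟨_, h₁, ?_⟩
    rw [← Category.id_comp (_ ≫ c), ← h₂]
    simp only [Category.assoc] at h₁ h₂ ⊢
    rw [reassoc_of% h₁, h₂]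
  exact ⟨asIso c, hc⟩

variable [HasZeroObject C]

lemma Realizes.comp_eq_zero (h𝓔 : 𝓔.IsExtriangulated) (h : Realizes x y δ) : x ≫ y = 0 := by
  obtain ⟨c, hc, -⟩ := h𝓔.et3 (h𝓔.realizes_zero A (0 : C)) h (𝟙 A) (biprod.fst ≫ x) (by simp)
  simpa using (congrArg (fun t => biprod.inl ≫ t) hc).symm

lemma Realizes.exists_fac_left (h𝓔 : 𝓔.IsExtriangulated) (h : Realizes x y δ) {P : C} (f : P ⟶ B)
    (hf : f ≫ y = 0) : ∃ u : P ⟶ A, u ≫ x = f := by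
  obtain ⟨a, ha, -⟩ := h𝓔.et3_op (h𝓔.realizes_zero P (0 : C)) h (biprod.fst ≫ f) 0 (by simp [hf])
  exact ⟨a, by simpa using ha.symm⟩

lemma Realizes.exists_fac_right (h𝓔 : 𝓔.IsExtriangulated) (h : Realizes x y δ) {P : C}
    (f : B ⟶ P) (hf : x ≫ f = 0) : ∃ u : D ⟶ P, y ≫ u = f := by
  obtain ⟨c, hc, -⟩ := h𝓔.et3 h (h𝓔.realizes_zero (0 : C) P) 0 (f ≫ biprod.inr)
    (by simp [reassoc_of% hf])
  exact ⟨c, by simpa using hc⟩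

/-- The five lemma. Two applications of the four lemma give one-sided inverses of `b`. -/
lemma isIso_mid (h𝓔 : 𝓔.IsExtriangulated) (h : Realizes x y δ) (h' : Realizes x' y' δ')
    (a : A ≅ A') (b : B ⟶ B') (c : D ≅ D') (hx : x ≫ b = a.hom ≫ x') (hy : y ≫ c.hom = b ≫ y')
    (hδ : push a.hom δ = pull c.hom δ') : IsIso b := by
  have hδ₁ : pull c.inv δ = push a.inv δ' := by
    calc pull c.inv δ = push a.inv (pull c.inv (push a.hom δ)) := by
          rw [← push_pull, ← push_comp]; simp
      _ = push a.inv δ' := by rw [hδ, ← pull_comp]; simp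
  obtain ⟨s, hs⟩ : ∃ s : B' ⟶ B, s ≫ b = 𝟙 B' := by
    obtain ⟨s, hs⟩ := exists_lift h𝓔 h (y' ≫ c.inv) (by
      rw [pull_comp, hδ₁, ← push_pull, h'.pull_eq_zero h𝓔, push_zero])
    obtain ⟨u, hu⟩ := h'.exists_fac_left h𝓔 (s ≫ b - 𝟙 B') (by simp [← hy, reassoc_of% hs])
    exact ⟨s - u ≫ a.inv ≫ x, by simp [hx, hu]⟩
  obtain ⟨t, ht⟩ : ∃ t : B' ⟶ B, b ≫ t = 𝟙 B := by
    obtain ⟨t, ht⟩ := exists_extension h𝓔 h' (a.inv ≫ x) (by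
      rw [push_comp, ← hδ₁, push_pull, h.push_eq_zero h𝓔, pull_zero])
    obtain ⟨u, hu⟩ := h.exists_fac_right h𝓔 (b ≫ t - 𝟙 B) (by simp [reassoc_of% hx, ht])
    exact ⟨t - y' ≫ c.inv ≫ u, by simp [← reassoc_of% hy, hu]⟩
  have hst : s = t := by
    rw [← Category.comp_id s, ← ht, ← Category.assoc, hs, Category.id_comp]
  exact ⟨s, by rw [hst, ht], hs⟩

/-- `E`-triangles can be transported along isomorphisms of their end terms. -/
lemma Realizes.of_iso (h𝓔 : 𝓔.IsExtriangulated) (h : Realizes x y δ) (a : A ≅ A') (c : D ≅ D')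
    (δ' : 𝓔.Ext D' A') (hδ : push a.hom δ = pull c.hom δ') :
    Realizes (a.inv ≫ x) (y ≫ c.hom) δ' := by
  obtain ⟨M, p, q, hM⟩ := exists_realizes δ'
  obtain ⟨b, hb, hb'⟩ := h𝓔.realization h hM a.hom c.hom hδ
  have := isIso_mid h𝓔 h hM a b c hb hb' hδ
  exact hM.of_iso_mid (asIso b).symm (by simp [IsIso.comp_inv_eq, hb]) (by simp [hb'])

end Exact

/-! ### Proper classes -/

section Proper

variable {ξ : Set 𝓔.ETriangle}

lemma IsProperClass.mem_of_eq_pull (hξ : IsProperClass ξ) {A B D B' D' : C} {x : A ⟶ B}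
    {y : B ⟶ D} {δ : 𝓔.Ext D A} (h : Realizes x y δ) (hT : (⟨x, y, δ, h⟩ : 𝓔.ETriangle) ∈ ξ)
    {x' : A ⟶ B'} {y' : B' ⟶ D'} {δ' : 𝓔.Ext D' A} (h' : Realizes x' y' δ') (c : D' ⟶ D)
    (hδ : δ' = pull c δ) : (⟨x', y', δ', h'⟩ : 𝓔.ETriangle) ∈ ξ := by
  subst hδ
  exact hξ.base_change _ hT c x' y' h'

lemma IsProperClass.mem_of_eq_push (hξ : IsProperClass ξ) {A B D A' B' : C} {x : A ⟶ B}
    {y : B ⟶ D} {δ : 𝓔.Ext D A} (h : Realizes x y δ) (hT : (⟨x, y, δ, h⟩ : 𝓔.ETriangle) ∈ ξ)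
    {x' : A' ⟶ B'} {y' : B' ⟶ D} {δ' : 𝓔.Ext D A'} (h' : Realizes x' y' δ') (a : A ⟶ A')
    (hδ : δ' = push a δ) : (⟨x', y', δ', h'⟩ : 𝓔.ETriangle) ∈ ξ := by
  subst hδ
  exact hξ.cobase_change _ hT a x' y' h'

/-- The dual of saturation. The base change of `ρ` along `r` is annihilated by `x_*`, hence it is
a base change of `δ` and belongs to `ξ`, and saturation applies to `r`. -/
lemma IsProperClass.mem_of_push_mem (h𝓔 : 𝓔.IsExtriangulated) (hξ : IsProperClass ξ)
    {A B D N M P : C} {x : A ⟶ B} {y : B ⟶ D} {δ : 𝓔.Ext D A} (h : Realizes x y δ)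
    (hT : (⟨x, y, δ, h⟩ : 𝓔.ETriangle) ∈ ξ)
    {p : A ⟶ M} {q : M ⟶ N} {ρ : 𝓔.Ext N A} (hρ : Realizes p q ρ)
    {s : B ⟶ P} {r : P ⟶ N} (hr : Realizes s r (push x ρ))
    (hS : (⟨s, r, _, hr⟩ : 𝓔.ETriangle) ∈ ξ) : (⟨p, q, ρ, hρ⟩ : 𝓔.ETriangle) ∈ ξ := by
  obtain ⟨t, ht⟩ := exists_eq_pull h𝓔 h (pull r ρ) (by rw [push_pull, hr.pull_eq_zero h𝓔])
  obtain ⟨Q, m, e, hQ⟩ := exists_realizes (pull r ρ)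
  exact hξ.saturated p q ρ hρ s r _ hr m e hQ hS (hξ.mem_of_eq_pull h hT hQ t ht)

end Proper

/-! ### Biexact `E`-triangles -/

/-- An `E`-triangle in `ξ` which is `C(-, 𝒲)`-exact and `C(𝒱, -)`-exact. Exactness at the middle
terms is automatic and is left out. -/
structure IsBiexact (ξ : Set 𝓔.ETriangle) (𝒲 𝒱 : ObjectProperty C) {A B D : C} (x : A ⟶ B)
    (y : B ⟶ D) (δ : 𝓔.Ext D A) : Prop where
  realizes : Realizes x y δ
  mem : (⟨x, y, δ, realizes⟩ : 𝓔.ETriangle) ∈ ξ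
  extend : ∀ {V : C}, 𝒲 V → ∀ f : A ⟶ V, ∃ g : B ⟶ V, x ≫ g = f
  eq_zero_of_comp : ∀ {V : C}, 𝒲 V → ∀ f : D ⟶ V, y ≫ f = 0 → f = 0
  lift : ∀ {V : C}, 𝒱 V → ∀ f : V ⟶ D, ∃ g : V ⟶ B, g ≫ y = f
  eq_zero_of_comp' : ∀ {V : C}, 𝒱 V → ∀ f : V ⟶ A, f ≫ x = 0 → f = 0

variable {ξ : Set 𝓔.ETriangle} {𝒲 𝒱 : ObjectProperty C}

section

variable [HasZeroObject C] {A B D : C} {x : A ⟶ B} {y : B ⟶ D} {δ : 𝓔.Ext D A}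

lemma homToExact_iff (h𝓔 : 𝓔.IsExtriangulated) (T : 𝓔.ETriangle) (V : C) :
    T.HomToExact V ↔ (∀ f : T.A ⟶ V, ∃ g : T.B ⟶ V, T.x ≫ g = f) ∧
      ∀ f : T.D ⟶ V, T.y ≫ f = 0 → f = 0 := by
  constructor
  · rintro ⟨h₁, -, h₃⟩
    exact ⟨h₃, fun f hf => h₁ (by simpa using hf)⟩
  · rintro ⟨h₁, h₂⟩
    refine ⟨fun f g hfg => ?_, fun f => ⟨fun hf => ?_, ?_⟩, h₁⟩
    · exact sub_eq_zero.1 (h₂ _ (by simpa [sub_eq_zero] using hfg))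
    · exact T.realizes.exists_fac_right h𝓔 f hf
    · rintro ⟨u, rfl⟩
      simp [reassoc_of% T.realizes.comp_eq_zero h𝓔]

lemma homFromExact_iff (h𝓔 : 𝓔.IsExtriangulated) (T : 𝓔.ETriangle) (V : C) :
    T.HomFromExact V ↔ (∀ f : V ⟶ T.D, ∃ g : V ⟶ T.B, g ≫ T.y = f) ∧
      ∀ f : V ⟶ T.A, f ≫ T.x = 0 → f = 0 := by
  constructor
  · rintro ⟨h₁, -, h₃⟩
    exact ⟨h₃, fun f hf => h₁ (by simpa using hf)⟩
  · rintro ⟨h₁, h₂⟩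
    refine ⟨fun f g hfg => ?_, fun f => ⟨fun hf => ?_, ?_⟩, h₁⟩
    · exact sub_eq_zero.1 (h₂ _ (by simpa [sub_eq_zero] using hfg))
    · exact T.realizes.exists_fac_left h𝓔 f hf
    · rintro ⟨u, rfl⟩
      simp [T.realizes.comp_eq_zero h𝓔]

lemma isBiexact_iff (h𝓔 : 𝓔.IsExtriangulated) (h : Realizes x y δ) :
    IsBiexact ξ 𝒲 𝒱 x y δ ↔
      (⟨x, y, δ, h⟩ : 𝓔.ETriangle) ∈ homToExactTriangles ξ 𝒲 ∩ homFromExactTriangles ξ 𝒱 := by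
  simp only [homToExactTriangles, homFromExactTriangles, homToExact_iff h𝓔,
    homFromExact_iff h𝓔]
  exact ⟨fun H => ⟨⟨H.mem, fun V hV => ⟨H.extend hV, H.eq_zero_of_comp hV⟩⟩, H.mem,
      fun V hV => ⟨H.lift hV, H.eq_zero_of_comp' hV⟩⟩,
    fun H => ⟨h, H.1.1, fun hV => (H.1.2 _ hV).1, fun hV => (H.1.2 _ hV).2,
      fun hV => (H.2.2 _ hV).1, fun hV => (H.2.2 _ hV).2⟩⟩

/-- (ET4) preserves biexactness. That `A ⟶ M ⟶ N` lies in `ξ` is dual saturation: its cobase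
change along `f` is a base change of `δ'`. -/
lemma IsBiexact.comp (h𝓔 : 𝓔.IsExtriangulated) (hξ : IsProperClass ξ) {A B D M F : C}
    {f : A ⟶ B} {f' : B ⟶ D} {δ : 𝓔.Ext D A} {g : B ⟶ M} {g' : M ⟶ F} {δ' : 𝓔.Ext F B}
    (H : IsBiexact ξ 𝒲 𝒱 f f' δ) (H' : IsBiexact ξ 𝒲 𝒱 g g' δ') :
    ∃ (N : C) (h : M ⟶ N) (d : D ⟶ N) (e : N ⟶ F) (δ'' : 𝓔.Ext N A),
      IsBiexact ξ 𝒲 𝒱 (f ≫ g) h δ'' ∧ IsBiexact ξ 𝒲 𝒱 d e (push f' δ') := by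
  obtain ⟨N, h, d, e, δ'', h₁, h₂, h₃, h₄, h₅, h₆⟩ := h𝓔.et4 H.realizes H'.realizes
  refine ⟨N, h, d, e, δ'', ⟨h₃, ?_, ?_, ?_, ?_, ?_⟩, ⟨h₄, ?_, ?_, ?_, ?_, ?_⟩⟩
  · obtain ⟨P, s, r, hr⟩ := exists_realizes (push f δ'')
    exact hξ.mem_of_push_mem h𝓔 H.realizes H.mem h₃ hr
      (hξ.mem_of_eq_pull H'.realizes H'.mem hr e h₆)
  · intro V hV k
    obtain ⟨k₁, rfl⟩ := H.extend hV k
    obtain ⟨k₂, rfl⟩ := H'.extend hV k₁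
    exact ⟨k₂, by simp⟩
  · intro V hV k hk
    have hdk : d ≫ k = 0 := H.eq_zero_of_comp hV _ (by rw [← reassoc_of% h₁, hk, comp_zero])
    obtain ⟨k', rfl⟩ := h₄.exists_fac_right h𝓔 k hdk
    rw [H'.eq_zero_of_comp hV k' (by rw [← h₂, Category.assoc, hk]), comp_zero]
  · intro V hV k
    obtain ⟨m, hm⟩ := H'.lift hV (k ≫ e)
    obtain ⟨t, ht⟩ := h₄.exists_fac_left h𝓔 (k - m ≫ h) (by simp [h₂, hm])
    obtain ⟨s, rfl⟩ := H.lift hV t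
    exact ⟨m + s ≫ g, by
      rw [Preadditive.add_comp, Category.assoc s, h₁, ← Category.assoc s, ht, add_sub_cancel]⟩
  · intro V hV k hk
    exact H.eq_zero_of_comp' hV _ (H'.eq_zero_of_comp' hV _ (by simpa using hk))
  · exact hξ.mem_of_eq_push H'.realizes H'.mem h₄ f' rfl
  · intro V hV k
    refine exists_extension h𝓔 h₄ k ?_
    obtain ⟨l, hl⟩ := H'.extend hV (f' ≫ k)
    rw [← push_comp, ← hl, push_comp, H'.realizes.push_eq_zero h𝓔, push_zero]
  · intro V hV k hk
    exact H'.eq_zero_of_comp hV k (by rw [← h₂, Category.assoc, hk, comp_zero])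
  · intro V hV k
    obtain ⟨m, hm⟩ := H'.lift hV k
    exact ⟨m ≫ h, by rw [Category.assoc, h₂, hm]⟩
  · intro V hV k hk
    obtain ⟨s, rfl⟩ := H.lift hV k
    obtain ⟨r, hr⟩ := h₃.exists_fac_left h𝓔 (s ≫ g) (by simpa [h₁] using hk)
    have : s = r ≫ f := by
      rw [← sub_eq_zero]
      exact H'.eq_zero_of_comp' hV _ (by simp [hr])
    rw [this, Category.assoc, H.realizes.comp_eq_zero h𝓔, comp_zero]

/-- If `α : A ⟶ V` satisfies `α_* δ = 0`, that is, extends along `x`, then the cobase change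
along `x` of a triangle `A ⟶ V ⟶ A'` has the middle term `V ⊞ D`. The class `δ''` produced by
(ET4) from `α` and the split triangle `V ⟶ V ⊞ D ⟶ D` lives on `N ≅ A' ⊞ D`; the section `σ` of
`e : N ⟶ D` is chosen such that `δ''` restricts to `δ` along it, and (ET4)ᵒᵖ for the
complementary projection `ρ : N ⟶ A'` gives the result. -/
lemma exists_cobaseChange (h𝓔 : 𝓔.IsExtriangulated) {A B D V A' : C}
    {x : A ⟶ B} {y : B ⟶ D} {δ : 𝓔.Ext D A} (h : Realizes x y δ)
    {α : A ⟶ V} {α' : V ⟶ A'} {a : 𝓔.Ext A' A} (hα : Realizes α α' a) (hδ : push α δ = 0) :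
    ∃ (ψ : B ⟶ V ⊞ D) (ψ' : V ⊞ D ⟶ A'), Realizes ψ ψ' (push x a) ∧
      x ≫ ψ = α ≫ biprod.inl ∧ ψ ≫ biprod.snd = y ∧ biprod.inl ≫ ψ' = α' := by
  obtain ⟨N, h', d, e, δ'', h₁, h₂, h₃, h₄, h₅, h₆⟩ := h𝓔.et4 hα (h𝓔.realizes_zero V D)
  rw [push_zero] at h₄
  rw [pull_zero] at h₆
  obtain ⟨σ₀, hσ₀⟩ := exists_lift h𝓔 h₄ (𝟙 D) (by simp)
  obtain ⟨t, ht⟩ := exists_eq_pull h𝓔 hα (pull σ₀ δ'' - δ) (by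
    rw [push_sub_right, push_pull, h₆, hδ, pull_zero, sub_zero])
  obtain ⟨σ, hσe, hσδ⟩ : ∃ σ : D ⟶ N, σ ≫ e = 𝟙 D ∧ pull σ δ'' = δ := by
    refine ⟨σ₀ - t ≫ d, by simp [hσ₀, h₄.comp_eq_zero h𝓔], ?_⟩
    rw [pull_sub_left, pull_comp, h₅, ← ht, sub_sub_cancel]
  obtain ⟨r₀, hr₀⟩ := exists_extension h𝓔 h₄ (𝟙 A') (by simp)
  obtain ⟨ρ, hdρ, hσρ⟩ : ∃ ρ : N ⟶ A', d ≫ ρ = 𝟙 A' ∧ σ ≫ ρ = 0 :=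
    ⟨r₀ - e ≫ σ ≫ r₀, by simp [hr₀, reassoc_of% h₄.comp_eq_zero h𝓔],
      by simp [reassoc_of% hσe]⟩
  have hsplit : Realizes σ ρ (0 : 𝓔.Ext A' D) := by
    have hid : ρ ≫ d + e ≫ σ = 𝟙 N := by
      obtain ⟨u, hu⟩ := h₄.exists_fac_left h𝓔 (𝟙 N - e ≫ σ) (by simp [hσe])
      have : u = ρ := by
        have := congrArg (fun k => k ≫ ρ) hu
        simpa [hdρ, hσρ] using this
      rw [← this, hu, sub_add_cancel]
    refine (h𝓔.realizes_zero D A').of_iso_mid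
      ⟨biprod.desc σ d, biprod.lift e ρ, ?_, ?_⟩ (by simp) ?_
    · ext <;> simp [hσe, hdρ, hσρ, h₄.comp_eq_zero h𝓔]
    · simpa [biprod.lift_desc, add_comm] using hid
    · ext <;> simp [hdρ, hσρ]
  obtain ⟨Z, i, d₂, e₂, δ₃, k₁, k₂, k₃, k₄, k₅, k₆⟩ := h𝓔.et4_op h₃ hsplit
  rw [hσδ] at k₄
  obtain ⟨j, hj₁, hj₂⟩ := k₄.exists_iso h
  have hδ₃ : δ₃ = push d₂ a := by
    rw [← h₅, push_pull, k₆, ← pull_comp, hdρ, pull_id]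
  refine ⟨j.inv ≫ i, h' ≫ ρ, ?_, ?_, ?_, ?_⟩
  · have := k₃.of_iso h𝓔 j (Iso.refl A') (push x a) (by
      rw [hδ₃, ← push_comp, hj₁, Iso.refl_hom, pull_id])
    simpa using this
  · rw [← hj₁]
    simp [k₂]
  · rw [Category.assoc, Iso.inv_comp_eq, hj₂, ← h₂, reassoc_of% k₁, hσe, Category.comp_id]
  · rw [reassoc_of% h₁, hdρ, Category.comp_id]

/-- The sum of a biexact triangle `D ⟶ U ⟶ F` with the trivial triangle `V ⟶ V ⟶ 0`. -/
lemma IsBiexact.biprod_map_id (h𝓔 : 𝓔.IsExtriangulated) (hξ : IsProperClass ξ) {D U F : C}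
    {β : D ⟶ U} {β' : U ⟶ F} {b : 𝓔.Ext F D} (H : IsBiexact ξ 𝒲 𝒱 β β' b) (V : C) :
    IsBiexact ξ 𝒲 𝒱 (biprod.map (𝟙 V) β) (biprod.snd ≫ β') (push biprod.inr b) := by
  have hr : Realizes (biprod.map (𝟙 V) β) (biprod.snd ≫ β') (push biprod.inr b) := by
    have h₀ : Realizes (𝟙 V) (0 : V ⟶ 0) (0 : 𝓔.Ext 0 V) :=
      (h𝓔.realizes_zero V 0).of_iso_mid
        ⟨biprod.fst, biprod.inl,
          biprod.hom_ext' _ _ (by simp) ((isZero_zero C).eq_of_src _ _), by simp⟩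
        (by simp) ((isZero_zero C).eq_of_tgt _ _)
    have h₁ := (h𝓔.realizes_sum h₀ H.realizes).of_iso h𝓔 (Iso.refl _)
      (⟨biprod.snd, biprod.inr,
        biprod.hom_ext' _ _ ((isZero_zero C).eq_of_src _ _) (by simp), by simp⟩ : (0 : C) ⊞ F ≅ F)
      (push biprod.inr b) (by simp [extSum, push_pull])
    simpa using h₁
  refine ⟨hr, hξ.mem_of_eq_push H.realizes H.mem hr _ rfl, ?_, ?_, ?_, ?_⟩
  · intro V' hV f
    obtain ⟨g, hg⟩ := H.extend hV (biprod.inr ≫ f)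
    exact ⟨biprod.desc (biprod.inl ≫ f) g, by ext <;> simp [hg]⟩
  · intro V' hV f hf
    exact H.eq_zero_of_comp hV f (by simpa using congrArg (fun k => biprod.inr ≫ k) hf)
  · intro V' hV f
    obtain ⟨g, hg⟩ := H.lift hV f
    exact ⟨g ≫ biprod.inr, by simp [hg]⟩
  · intro V' hV f hf
    ext
    · simpa using congrArg (fun k => k ≫ biprod.fst) hf
    · rw [zero_comp]
      exact H.eq_zero_of_comp' hV _ (by simpa using congrArg (fun k => k ≫ biprod.snd) hf)

/-- The horseshoe lemma for one step of coresolutions. -/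
lemma IsBiexact.horseshoe (h𝓔 : 𝓔.IsExtriangulated) (hξ : IsProperClass ξ)
    {A Z D V U A' D' : C} {x : A ⟶ Z} {y : Z ⟶ D} {δ : 𝓔.Ext D A}
    {α : A ⟶ V} {α' : V ⟶ A'} {a : 𝓔.Ext A' A} {β : D ⟶ U} {β' : U ⟶ D'} {b : 𝓔.Ext D' D}
    (hV : 𝒲 V) (H : IsBiexact ξ 𝒲 𝒱 x y δ) (Hα : IsBiexact ξ 𝒲 𝒱 α α' a)
    (Hβ : IsBiexact ξ 𝒲 𝒱 β β' b) :
    ∃ (g : Z ⟶ V ⊞ U) (Z' : C) (f : V ⊞ U ⟶ Z') (x' : A' ⟶ Z') (y' : Z' ⟶ D')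
      (θ : 𝓔.Ext Z' Z) (δ' : 𝓔.Ext D' A'),
      IsBiexact ξ 𝒲 𝒱 g f θ ∧ IsBiexact ξ 𝒲 𝒱 x' y' δ' := by
  obtain ⟨α₁, hα₁⟩ := H.extend hV α
  obtain ⟨ψ, ψ', hψ, hxψ, hψy, hψ'⟩ := exists_cobaseChange h𝓔 H.realizes Hα.realizes
    (by rw [← hα₁, push_comp, H.realizes.push_eq_zero h𝓔, push_zero])
  have Hψ : IsBiexact ξ 𝒲 𝒱 ψ ψ' (push x a) := by
    refine ⟨hψ, hξ.mem_of_eq_push Hα.realizes Hα.mem hψ x rfl, ?_, ?_, ?_, ?_⟩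
    · intro V' hV' f
      obtain ⟨g, hg⟩ := Hα.extend hV' (x ≫ f)
      exact exists_extension h𝓔 hψ f (by
        rw [← push_comp, ← hg, push_comp, Hα.realizes.push_eq_zero h𝓔, push_zero])
    · intro V' hV' f hf
      exact Hα.eq_zero_of_comp hV' f (by rw [← hψ', Category.assoc, hf, comp_zero])
    · intro V' hV' f
      obtain ⟨g, hg⟩ := Hα.lift hV' f
      exact ⟨g ≫ biprod.inl, by rw [Category.assoc, hψ', hg]⟩
    · intro V' hV' f hf
      obtain ⟨t, rfl⟩ := H.realizes.exists_fac_left h𝓔 f (by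
        rw [← hψy, reassoc_of% hf, zero_comp])
      have ht : t ≫ α = 0 := by
        simpa [hxψ] using congrArg (fun k => k ≫ biprod.fst) hf
      rw [Hα.eq_zero_of_comp' hV' t ht, zero_comp]
  obtain ⟨Z', f, x', y', θ, H₁, H₂⟩ := Hψ.comp h𝓔 hξ (Hβ.biprod_map_id h𝓔 hξ V)
  exact ⟨_, Z', f, x', y', θ, _, H₁, H₂⟩

end

/-! ### Spliced sequences -/

variable [HasZeroObject C]

/-- The splicing triangles of a coproper coresolution are unique up to isomorphism, since the
deflations in them are epimorphisms with respect to maps to `𝒲`. Hence separate exactness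
properties hold for one common choice of triangles. -/
lemma IsCoproperCoresolution.isSpliced_inter (h𝓔 : 𝓔.IsExtriangulated) {ℓ : ℕ∞} {Y : C}
    {W : ℕ → C} {ε : Y ⟶ W 0} {d : ∀ i, W i ⟶ W (i + 1)}
    (h : IsCoproperCoresolution ξ 𝒲 ℓ Y W ε d)
    (h' : IsSpliced (homFromExactTriangles ξ 𝒱) ℓ Y W ε d) :
    IsSpliced (homToExactTriangles ξ 𝒲 ∩ homFromExactTriangles ξ 𝒱) ℓ Y W ε d := by
  obtain ⟨hW, K, g, f, h₀, h₁, h₂⟩ := h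
  obtain ⟨K', g', f', h₀', h₁', h₂'⟩ := h'
  have key : ∀ i : ℕ, (i : ℕ∞) < ℓ →
      ∃ c : consObj Y K i ≅ consObj Y K' i, g i = c.hom ≫ g' i := by
    intro i
    induction i with
    | zero =>
      intro _
      refine ⟨Iso.refl Y, ?_⟩
      rw [h₀, h₀', Iso.refl_hom]
      exact (Category.id_comp ε).symm
    | succ i ih =>
      intro hi
      have hi' : (i : ℕ∞) < ℓ := lt_of_le_of_lt (by simp) hi
      obtain ⟨c, hc⟩ := ih hi'
      obtain ⟨δ, hr, hT⟩ := h₂ i hi'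
      obtain ⟨δ', hr', hT'⟩ := h₂' i hi'
      obtain ⟨c', hc'⟩ := exists_iso_right h𝓔 hr hr' c (Iso.refl _) (by simpa using hc)
      rw [Iso.refl_hom, Category.id_comp] at hc'
      refine ⟨c', ?_⟩
      refine (hT.2 _ (hW _ hi)).1 ?_
      exact (h₁ i hi).symm.trans ((h₁' i hi).trans (by
        rw [← hc']; exact Category.assoc _ _ _))
  refine ⟨K, g, f, h₀, h₁, fun i hi => ?_⟩
  obtain ⟨δ, hr, hT⟩ := h₂ i hi
  obtain ⟨δ', hr', hT'⟩ := h₂' i hi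
  obtain ⟨c, hc⟩ := key i hi
  obtain ⟨c', hc'⟩ := exists_iso_right h𝓔 hr hr' c (Iso.refl _) (by simpa using hc)
  rw [Iso.refl_hom, Category.id_comp] at hc'
  refine ⟨δ, hr, hT, hT.1, fun V hV => (homFromExact_iff h𝓔 _ _).2 ?_⟩
  obtain ⟨H₁, H₂⟩ := (homFromExact_iff h𝓔 _ _).1 (hT'.2 V hV)
  refine ⟨fun k => ?_, fun k hk => ?_⟩
  · obtain ⟨l, hl⟩ := H₁ (k ≫ c'.hom)
    exact ⟨l, by simpa [← hc', ← Category.assoc] using hl⟩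
  · have := H₂ (k ≫ c.hom) (by simpa [hc] using hk)
    simpa using this

lemma exists_dependent_seq {S : ℕ → Type*} {R : ∀ i, S i → S (i + 1) → Prop} (s₀ : S 0)
    (step : ∀ i s, ∃ s', R i s s') : ∃ s : ∀ i, S i, s 0 = s₀ ∧ ∀ i, R i (s i) (s (i + 1)) := by
  choose next hnext using step
  exact ⟨fun i => Nat.rec s₀ next i, rfl, fun i => hnext i _⟩

/-- The biexact form of the result, for the second class `𝒱` independent of `𝒲`. -/
theorem exists_isSpliced_sumTerms (h𝓔 : 𝓔.IsExtriangulated) (hξ : IsProperClass ξ)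
    {Y Y₀ Y₁ : C} {x : Y ⟶ Y₀} {y : Y₀ ⟶ Y₁} {δ : 𝓔.Ext Y₁ Y} (hT : IsBiexact ξ 𝒲 𝒱 x y δ)
    (n : ℕ∞)
    {W₀ : ℕ → C} {ε₀ : Y₀ ⟶ W₀ 0} {d₀ : ∀ i, W₀ i ⟶ W₀ (i + 1)}
    (h₀ : IsSpliced (homToExactTriangles ξ 𝒲 ∩ homFromExactTriangles ξ 𝒱) (n + 1) Y₀ W₀ ε₀ d₀)
    {W₁ : ℕ → C} {ε₁ : Y₁ ⟶ W₁ 0} {d₁ : ∀ i, W₁ i ⟶ W₁ (i + 1)}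
    (hW₁ : ∀ i : ℕ, (i : ℕ∞) < n → 𝒲 (W₁ i))
    (h₁ : IsSpliced (homToExactTriangles ξ 𝒲 ∩ homFromExactTriangles ξ 𝒱) n Y₁ W₁ ε₁ d₁) :
    ∃ (ε : Y ⟶ sumTerms W₀ W₁ 0) (d : ∀ i, sumTerms W₀ W₁ i ⟶ sumTerms W₀ W₁ (i + 1)),
      IsSpliced (homToExactTriangles ξ 𝒲 ∩ homFromExactTriangles ξ 𝒱) (n + 1) Y
        (sumTerms W₀ W₁) ε d := by
  obtain ⟨K₀, g₀, f₀, -, -, hK₀⟩ := h₀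
  obtain ⟨K₁, g₁, f₁, -, -, hK₁⟩ := h₁
  have hK₀ : ∀ i : ℕ, (i : ℕ∞) < n + 1 →
      ∃ θ : 𝓔.Ext _ _, IsBiexact ξ 𝒲 𝒱 (g₀ i) (f₀ i) θ := fun i hi => by
    obtain ⟨θ, h, hθ⟩ := hK₀ i hi
    exact ⟨θ, (isBiexact_iff h𝓔 h).2 hθ⟩
  have hK₁ : ∀ i : ℕ, (i : ℕ∞) < n →
      ∃ θ : 𝓔.Ext _ _, IsBiexact ξ 𝒲 𝒱 (g₁ i) (f₁ i) θ := fun i hi => by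
    obtain ⟨θ, h, hθ⟩ := hK₁ i hi
    exact ⟨θ, (isBiexact_iff h𝓔 h).2 hθ⟩
  have hlt : ∀ i : ℕ, ((i + 1 : ℕ) : ℕ∞) < n + 1 → (i : ℕ∞) < n := fun i hi => by
    rw [Nat.cast_add, Nat.cast_one] at hi
    exact (ENat.add_lt_add_iff_right ENat.one_ne_top).1 hi
  -- `S i` consists of the candidates for the object `Z_{i+1}`; nothing is required of them beyond
  -- degree `n`, where the given triangles end.
  let S : ℕ → Type _ := fun i => Σ' (Z : C) (s : consObj Y₁ K₁ i ⟶ Z) (t : Z ⟶ K₀ i),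
    (i : ℕ∞) < n + 1 → ∃ θ : 𝓔.Ext _ _, IsBiexact ξ 𝒲 𝒱 s t θ
  obtain ⟨θ₀, hθ₀⟩ := hK₀ 0 (by simp)
  obtain ⟨Z, p, s, t, θ, hp, hst⟩ := hT.comp h𝓔 hξ hθ₀
  let R : ∀ i, S i → S (i + 1) → Prop := fun i s s' =>
    ∃ (g : s.1 ⟶ W₁ i ⊞ W₀ (i + 1)) (f : W₁ i ⊞ W₀ (i + 1) ⟶ s'.1),
      ((i + 1 : ℕ) : ℕ∞) < n + 1 → ∃ θ : 𝓔.Ext _ _, IsBiexact ξ 𝒲 𝒱 g f θ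
  have step : ∀ i s, ∃ s', R i s s' := by
    rintro i ⟨Z, s, t, hZ⟩
    by_cases hi : ((i + 1 : ℕ) : ℕ∞) < n + 1
    · obtain ⟨θ, hθ⟩ := hZ (lt_of_le_of_lt (by simp) hi)
      obtain ⟨θ₀, hθ₀⟩ := hK₀ (i + 1) hi
      obtain ⟨θ₁, hθ₁⟩ := hK₁ i (hlt i hi)
      obtain ⟨g, Z', f, s', t', η, θ', H₁, H₂⟩ := hθ.horseshoe h𝓔 hξ (hW₁ i (hlt i hi)) hθ₁ hθ₀
      exact ⟨⟨Z', s', t', fun _ => ⟨θ', H₂⟩⟩, g, f, fun _ => ⟨η, H₁⟩⟩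
    · exact ⟨⟨K₀ (i + 1), 0, 𝟙 _, fun h => absurd h hi⟩, 0, 0, fun h => absurd h hi⟩
  obtain ⟨σ, hσ₀, hσ⟩ := exists_dependent_seq (S := S) (R := R) ⟨Z, s, t, fun _ => ⟨_, hst⟩⟩ step
  choose g f hgf using hσ
  obtain ⟨p', hp'⟩ : ∃ p' : W₀ 0 ⟶ (σ 0).1, ∃ θ : 𝓔.Ext _ _,
      IsBiexact ξ 𝒲 𝒱 (x ≫ g₀ 0) p' θ := by
    rw [hσ₀]
    exact ⟨p, θ, hp⟩
  let G : ∀ i, consObj Y (fun i => (σ i).1) i ⟶ sumTerms W₀ W₁ i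
    | 0 => x ≫ g₀ 0
    | i + 1 => g i
  let F : ∀ i, sumTerms W₀ W₁ i ⟶ (σ i).1
    | 0 => p'
    | i + 1 => f i
  refine ⟨G 0, fun i => F i ≫ G (i + 1), fun i => (σ i).1, G, F, rfl, fun _ _ => rfl, ?_⟩
  rintro (_ | i) hi
  · obtain ⟨η, hη⟩ := hp'
    exact ⟨η, hη.realizes, (isBiexact_iff h𝓔 hη.realizes).1 hη⟩
  · obtain ⟨η, hη⟩ := hgf i hi
    exact ⟨η, hη.realizes, (isBiexact_iff h𝓔 hη.realizes).1 hη⟩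

end ExtData

end Extriangulated

theorem mainTheorem5 {C : Type u} [Category.{v} C] [Preadditive C] [HasZeroObject C] [HasBinaryBiproducts C]
    (𝓔 : ExtData.{w} C) (h𝓔 : 𝓔.IsExtriangulated) (hWIC : 𝓔.WIC)
    (ξ : Set 𝓔.ETriangle) (hξ : IsProperClass ξ)
    (hproj : EnoughXiProjectives ξ) (hinj : EnoughXiInjectives ξ)
    (𝒲 : ObjectProperty C) (h𝒲 : ∀ A B : C, 𝒲 A → 𝒲 B → 𝒲 (A ⊞ B))
    -- the `C(-, 𝒲)`-exact `E`-triangle `Y ⟶ Y⁰ ⟶ Y¹ ⇢` in `ξ`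
    {Y Y₀ Y₁ : C} (x : Y ⟶ Y₀) (y : Y₀ ⟶ Y₁) (δ : 𝓔.Ext Y₁ Y) (hδ : Realizes x y δ)
    (hT : (⟨x, y, δ, hδ⟩ : 𝓔.ETriangle) ∈ homToExactTriangles ξ 𝒲)
    -- `n` is a natural number or infinity
    (n : ℕ∞)
    -- the coresolution of `Y⁰` has the terms of degrees `0, …, n`
    (W₀ : ℕ → C) (ε₀ : Y₀ ⟶ W₀ 0) (d₀ : ∀ i, W₀ i ⟶ W₀ (i + 1))
    (hW₀ : IsCoproperCoresolution ξ 𝒲 (n + 1) Y₀ W₀ ε₀ d₀)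
    -- the coresolution of `Y¹` has the terms of degrees `0, …, n - 1`
    (W₁ : ℕ → C) (ε₁ : Y₁ ⟶ W₁ 0) (d₁ : ∀ i, W₁ i ⟶ W₁ (i + 1))
    (hW₁ : IsCoproperCoresolution ξ 𝒲 n Y₁ W₁ ε₁ d₁) :
    ∃ (ε : Y ⟶ sumTerms W₀ W₁ 0) (d : ∀ i, sumTerms W₀ W₁ i ⟶ sumTerms W₀ W₁ (i + 1)),
      IsCoproperCoresolution ξ 𝒲 (n + 1) Y (sumTerms W₀ W₁) ε d ∧
      ((⟨x, y, δ, hδ⟩ : 𝓔.ETriangle) ∈ homFromExactTriangles ξ 𝒲 →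
        IsSpliced (homFromExactTriangles ξ 𝒲) (n + 1) Y₀ W₀ ε₀ d₀ →
        IsSpliced (homFromExactTriangles ξ 𝒲) n Y₁ W₁ ε₁ d₁ →
        IsSpliced (homFromExactTriangles ξ 𝒲) (n + 1) Y (sumTerms W₀ W₁) ε d) := by
  -- With `𝒱` equal to `𝒲` or empty, one construction serves both parts of the conclusion.
  let P : Prop := (⟨x, y, δ, hδ⟩ : 𝓔.ETriangle) ∈ homFromExactTriangles ξ 𝒲 ∧
    IsSpliced (homFromExactTriangles ξ 𝒲) (n + 1) Y₀ W₀ ε₀ d₀ ∧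
    IsSpliced (homFromExactTriangles ξ 𝒲) n Y₁ W₁ ε₁ d₁
  let 𝒱 : ObjectProperty C := fun V => P ∧ 𝒲 V
  have hP : P → homFromExactTriangles ξ 𝒱 = homFromExactTriangles ξ 𝒲 := fun h => by
    simp only [𝒱, h, true_and]
  have hnP : ¬ P → homFromExactTriangles ξ 𝒱 = ξ := fun h => by
    simp [homFromExactTriangles, 𝒱, h]
  obtain ⟨hT', h₀, h₁⟩ : (⟨x, y, δ, hδ⟩ : 𝓔.ETriangle) ∈ homFromExactTriangles ξ 𝒱 ∧
      IsSpliced (homFromExactTriangles ξ 𝒱) (n + 1) Y₀ W₀ ε₀ d₀ ∧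
      IsSpliced (homFromExactTriangles ξ 𝒱) n Y₁ W₁ ε₁ d₁ := by
    by_cases h : P
    · rw [hP h]
      exact h
    · rw [hnP h]
      exact ⟨hT.1, hW₀.2.mono fun _ hS => hS.1, hW₁.2.mono fun _ hS => hS.1⟩
  obtain ⟨ε, d, h⟩ := exists_isSpliced_sumTerms h𝓔 hξ ((isBiexact_iff h𝓔 hδ).2 ⟨hT, hT'⟩) n
    (hW₀.isSpliced_inter h𝓔 h₀) hW₁.1 (hW₁.isSpliced_inter h𝓔 h₁)
  refine ⟨ε, d, ⟨?_, h.mono Set.inter_subset_left⟩, fun hx hY₀ hY₁ => ?_⟩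
  · rintro (_ | i) hi
    · exact hW₀.1 0 hi
    · refine h𝒲 _ _ (hW₁.1 i ?_) (hW₀.1 (i + 1) hi)
      rw [Nat.cast_add, Nat.cast_one] at hi
      exact (ENat.add_lt_add_iff_right ENat.one_ne_top).1 hi
  · rw [← hP ⟨hx, hY₀, hY₁⟩]
    exact h.mono Set.inter_subset_right
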